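/- **The algorithm.** Let $k=2^{K}$ be a power of two (so $\log k=\log_2 k=K$), let $n,m\in\mathbb N$ and $p\in(0,1]$. The input of the $k$-Tree algorithm consists of lists $L_1,\dots,L_k$ of $n$ integers each. Put $L^0_i=L_i$. For $d=1,\dots,\log k$ and $i=1,\dots,k/2^d$, let $L^d_i$ be the list (with multiplicity) of all sums $a+b$, one for each pair of an entry $a$ of $L^{d-1}_{2i-1}$ and an entry $b$ of $L^{d-1}_{2i}$, such that $|a+b|\le p^d m/2$. Let $C=C_{k,n,m,p}$ be the number of occurrences of $0$ in the final list $L^{\log k}_1$, where the $kn$ entries of the input lists are independent and uniformly distributed on $\{-\lfloor m/2\rfloor,\dots,\lfloor m/2\rfloor\}$. **Proposition 2.4.** Let $k,n,m,p$ be as above with $m p^{\log k-1}>30$ and $p<1/30$. Set $$\mu=p\,(1-p)^{-1}\Bigl(1+\frac{35}{m p^{\log k}}\Bigr),\qquad \nu=\frac{1}{m p^{\log k+1}}.$$ Then $$\mathbb E[C^2]\;\le\; n^k\mu^k\nu\,\bigl(1+T_{\mu,n,\nu}(k)\bigr),$$ where $T_{\mu,n,\nu}$ is defined on powers of two by $T_{\mu,n,\nu}(1)=n\mu\nu$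 and, for every power of two $j\ge 2$, $$T_{\mu,n,\nu}(j)=T_{\mu,n,\nu}(j/2)\Bigl(\frac{T_{\mu,n,\nu}(j/2)}{\nu}+2\mu\Bigr).$$ -/

import Mathlib

open MeasureTheory ProbabilityTheory

namespace KTree

/-- The set of integers from `-⌊m/2⌋` to `⌊m/2⌋`. -/
def intRange (m : ℕ) : Set ℤ := Set.Icc (-((m / 2 : ℕ) : ℤ)) ((m / 2 : ℕ) : ℤ)

/-- Merge: all sums `a + b` with `a` in `La`, `b` in `Lb` and `|a + b| ≤ τ`, one copy for each
pair of positions. -/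
noncomputable def mergeLists (τ : ℝ) (La Lb : List ℤ) : List ℤ :=
  ((La ×ˢ Lb).map (fun q => q.1 + q.2)).filter (fun c => |(c : ℝ)| ≤ τ)

/-- The threshold used at level `d`: it starts at `m / 2` and is multiplied by `p` each time. -/
noncomputable def threshold (m : ℕ) (p : ℝ) : ℕ → ℝ
  | 0 => (m : ℝ) / 2
  | d + 1 => p * threshold m p d

/-- The `i`-th list at level `d` of the tree, on input lists `L 0, L 1, …`. Lists are numbered
from `0`, so list `i` at level `d + 1` is merged from lists `2 * i` and `2 * i + 1` at level `d`. -/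
noncomputable def level (m : ℕ) (p : ℝ) (L : ℕ → List ℤ) : ℕ → ℕ → List ℤ
  | 0, i => L i
  | d + 1, i =>
      mergeLists (threshold m p (d + 1)) (level m p L d (2 * i)) (level m p L d (2 * i + 1))

/-- The input lists given by an array of entries: list `i < k` consists of the `n` integers
`x i 0, …, x i (n - 1)`. There are no lists beyond the first `k` (they are read as empty; the
algorithm never looks at them). -/
def inputLists {k n : ℕ} (x : Fin k → Fin n → ℤ) (i : ℕ) : List ℤ :=
  if h : i < k then List.ofFn (x ⟨i, h⟩) else []

/-- The number of occurrences of `0` in the final list (at level `log₂ k`) of the `k`-Tree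
algorithm on the input lists with entries `x`, where `k` is a power of two. -/
noncomputable def zeroCount {k n : ℕ} (m : ℕ) (p : ℝ) (x : Fin k → Fin n → ℤ) : ℕ :=
  (level m p (inputLists x) (Nat.log 2 k) 0).count 0

/-- The function with `T 1 = n * μ * ν` and `T k = T (k/2) * (T (k/2) / ν + 2 * μ)` for larger
`k`, of interest when `k` is a power of two. -/
noncomputable def T (μ : ℝ) (n : ℕ) (ν : ℝ) (k : ℕ) : ℝ :=
  if k ≤ 1 then n * μ * ν
  else T μ n ν (k / 2) * (T μ n ν (k / 2) / ν + 2 * μ)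
termination_by k
decreasing_by all_goals omega

end KTree

/-!
Let `N x` be the number of occurrences of `x` in the list at a node of level `d`, and consider the
mixed second moment `H x y = E[N x * N y]`. Below a fixed node the solutions come in pairs, and a
pair either coincides (which forces `x = y`) or not; this suggests a bound of the shape
`H x y ≤ α d * 1[x = y] + β d`, uniform over the nodes of level `d`.

Such bounds pass from a level to the next. The occurrences of `x` at a node number at most
`∑ a, N₁ a * N₂ (x - a)`, where `a` runs over the window `|a| ≤ p ^ d * m / 2` of the child level,
which holds at most `w = p ^ d * m + 1` integers, and where `N₁`, `N₂` count in the two children and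
are independent because these see disjoint sets of entries (`secondMoment_succ_le`). Expanding the
product of the two bounds gives (`sum_sum_diagonal_le`)
`α (d + 1) = α d ^ 2 * w`, `β (d + 1) = 2 * α d * β d * w + β d ^ 2 * w ^ 2`, from
`α 0 = n / m`, `β 0 = (n / m) ^ 2` at the leaves (`secondMoment_zero_le`).

Write `β d = α d * t d`; then `t (d + 1) = t d * (t d * w + 2)`. If `w` were `p ^ d * m`, this would
be solved by `α d = s d * (n * p) ^ 2 ^ d` with `s d = 1 / (m * p ^ (d + 1))`, and `t d = s d * U d`
where `U` obeys the recursion of `T / ν` with `p` for `μ`. The surplus `1` in `w` costs a factor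
`c = 1 + 1 / (m * p ^ K)`, which is paid for by replacing `p` by `μ ≥ c * p`. At the root, where
`s K = ν`, the bound at `x = y = 0` is `α K + β K ≤ n ^ k * μ ^ k * ν * (1 + T k)`.
-/

namespace KTree

/-! ### Multiplicities in the lists of the tree -/

/-- The finite set of integers of absolute value at most `τ`. -/
noncomputable def window (τ : ℝ) : Finset ℤ := Finset.Icc (-⌊τ⌋) ⌊τ⌋

theorem mem_window {τ : ℝ} {a : ℤ} : a ∈ window τ ↔ |(a : ℝ)| ≤ τ := by
  rw [window, Finset.mem_Icc, abs_le, Int.le_floor, neg_le, Int.le_floor, Int.cast_neg, neg_le]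

theorem card_window_le {τ : ℝ} (hτ : 0 ≤ τ) : ((window τ).card : ℝ) ≤ 2 * τ + 1 := by
  have h0 : 0 ≤ ⌊τ⌋ := Int.floor_nonneg.2 hτ
  have h1 : ((window τ).card : ℤ) = 2 * ⌊τ⌋ + 1 := by
    rw [window, Int.card_Icc]
    omega
  have h2 : ((window τ).card : ℝ) = 2 * (⌊τ⌋ : ℝ) + 1 := by exact_mod_cast h1
  rw [h2]
  linarith [Int.floor_le τ]

theorem threshold_eq (m : ℕ) (p : ℝ) (d : ℕ) : threshold m p d = p ^ d * m / 2 := by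
  induction d with
  | zero => simp [threshold]
  | succ d ih => rw [threshold, ih]; ring

theorem count_map_add_product (A B : List ℤ) (F : Finset ℤ) (hF : ∀ a ∈ A, a ∈ F) (x : ℤ) :
    ((A ×ˢ B).map (fun q => q.1 + q.2)).count x = ∑ a ∈ F, A.count a * B.count (x - a) := by
  induction A with
  | nil => simp
  | cons a A ih =>
    have hB : ((B.map (fun b => (a, b))).map (fun q : ℤ × ℤ => q.1 + q.2)).count x
        = B.count (x - a) := by
      have h := List.count_map_of_injective B (fun b => a + b) (add_right_injective a) (x - a)
      rw [List.map_map, ← h]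
      congr 1
      ring
    have haF : a ∈ F := hF a (by simp)
    rw [List.product_cons, List.map_append, List.count_append, hB,
      ih fun b hb => hF b (List.mem_cons_of_mem _ hb)]
    simp only [List.count_cons, beq_iff_eq, add_mul, Finset.sum_add_distrib, ite_mul, one_mul,
      zero_mul, Finset.sum_ite_eq, haF, if_true]
    ring

theorem count_mergeLists (τ : ℝ) (A B : List ℤ) (F : Finset ℤ) (hF : ∀ a ∈ A, a ∈ F) (x : ℤ) :
    (mergeLists τ A B).count x
      = if |(x : ℝ)| ≤ τ then ∑ a ∈ F, A.count a * B.count (x - a) else 0 := by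
  unfold mergeLists
  split_ifs with h
  · rw [List.count_filter (by simpa using h), count_map_add_product A B F hF]
  · exact List.count_eq_zero.2 fun hx => h (by simpa using (List.mem_filter.1 hx).2)

/-- The number of occurrences of `a` in the `i`-th list at level `d`, as a function of the array
of all entries. -/
noncomputable def multiplicity (k n m : ℕ) (p : ℝ) (d i : ℕ) (a : ℤ)
    (ξ : Fin k × Fin n → ℤ) : ℝ :=
  ((level m p (inputLists fun i j => ξ (i, j)) d i).count a : ℝ)

theorem multiplicity_nonneg (k n m : ℕ) (p : ℝ) (d i : ℕ) (a : ℤ) (ξ : Fin k × Fin n → ℤ) :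
    0 ≤ multiplicity k n m p d i a ξ := Nat.cast_nonneg _

theorem length_level_le {k n : ℕ} (m : ℕ) (p : ℝ) (x : Fin k → Fin n → ℤ) (d i : ℕ) :
    (level m p (inputLists x) d i).length ≤ n ^ 2 ^ d := by
  induction d generalizing i with
  | zero =>
    rw [level, inputLists]
    split_ifs <;> simp
  | succ d ih =>
    rw [level, mergeLists]
    refine (List.length_filter_le _ _).trans ?_
    rw [List.length_map, List.length_product, pow_succ 2 d, pow_mul, sq]
    exact Nat.mul_le_mul (ih _) (ih _)

theorem multiplicity_le (k n m : ℕ) (p : ℝ) (d i : ℕ) (a : ℤ) (ξ : Fin k × Fin n → ℤ) :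
    multiplicity k n m p d i a ξ ≤ (n : ℝ) ^ 2 ^ d := by
  have h := (List.count_le_length (a := a)).trans
    (length_level_le m p (fun i j => ξ (i, j)) d i)
  unfold multiplicity
  exact_mod_cast h

theorem mem_window_of_mem_level {k n : ℕ} {m : ℕ} {p : ℝ} {x : Fin k → Fin n → ℤ}
    (hx : ∀ i j, x i j ∈ intRange m) {d i : ℕ} {a : ℤ}
    (ha : a ∈ level m p (inputLists x) d i) : a ∈ window (threshold m p d) := by
  rw [mem_window]
  cases d with
  | zero =>
    rw [level, inputLists] at ha
    split_ifs at ha with h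
    · obtain ⟨j, rfl⟩ := (List.mem_ofFn' _ _).1 ha
      have hj := hx ⟨i, h⟩ j
      have h1 : |x ⟨i, h⟩ j| ≤ ((m / 2 : ℕ) : ℤ) := abs_le.2 hj
      have h2 : |(x ⟨i, h⟩ j : ℝ)| ≤ ((m / 2 : ℕ) : ℝ) := by
        rw [← Int.cast_abs, ← Int.cast_natCast]
        exact Int.cast_le.2 h1
      exact h2.trans (by simpa [threshold] using Nat.cast_div_le (α := ℝ) (m := m) (n := 2))
    · simp at ha
  | succ d =>
    rw [level, mergeLists] at ha
    simpa using (List.mem_filter.1 ha).2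

/-- Only an inequality: the sums beyond the threshold are dropped on the left. -/
theorem multiplicity_succ_le {k n m : ℕ} {p : ℝ} {ξ : Fin k × Fin n → ℤ}
    (hξ : ∀ q, ξ q ∈ intRange m) (d i : ℕ) (x : ℤ) :
    multiplicity k n m p (d + 1) i x ξ ≤ ∑ a ∈ window (threshold m p d),
      multiplicity k n m p d (2 * i) a ξ * multiplicity k n m p d (2 * i + 1) (x - a) ξ := by
  unfold multiplicity
  rw [level, count_mergeLists _ _ _ (window (threshold m p d))
    fun a ha => mem_window_of_mem_level (fun i j => hξ (i, j)) ha]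
  split_ifs
  · push_cast
    exact le_rfl
  · push_cast
    positivity

/-- The input positions lying below the `i`-th node at level `d`. -/
def block (k n d i : ℕ) : Finset (Fin k × Fin n) :=
  Finset.univ.filter fun q => (q.1 : ℕ) / 2 ^ d = i

theorem block_succ_of_block {k n d i j : ℕ} (h : j / 2 = i) :
    block k n d j ⊆ block k n (d + 1) i := by
  intro q hq
  simp only [block, Finset.mem_filter, Finset.mem_univ, true_and] at hq ⊢
  rw [pow_succ, ← Nat.div_div_eq_div_mul, hq, h]

theorem disjoint_block (k n d : ℕ) {i j : ℕ} (h : i ≠ j) :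
    Disjoint (block k n d i) (block k n d j) := by
  rw [Finset.disjoint_left]
  intro q hi hj
  simp only [block, Finset.mem_filter, Finset.mem_univ, true_and] at hi hj
  exact h (hi.symm.trans hj)

theorem dependsOn_multiplicity (k n m : ℕ) (p : ℝ) (d i : ℕ) (a : ℤ) :
    DependsOn (multiplicity k n m p d i a) (block k n d i : Set (Fin k × Fin n)) := by
  intro ξ η h
  have key : level m p (inputLists fun i j => ξ (i, j)) d i
      = level m p (inputLists fun i j => η (i, j)) d i := by
    clear a
    induction d generalizing i with
    | zero =>
      rw [level, level, inputLists, inputLists]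
      split_ifs with hi
      · congr 1
        funext j
        exact h _ (by simp [block])
      · rfl
    | succ d ih =>
      rw [level, level,
        ih (2 * i) fun q hq => h q (block_succ_of_block (by omega) hq),
        ih (2 * i + 1) fun q hq => h q (block_succ_of_block (by omega) hq)]
  unfold multiplicity
  rw [key]

/-! ### Functions of independent integer variables -/

theorem indepFun_of_dependsOn {Ω ι : Type*} [MeasurableSpace Ω] [Fintype ι] {P : Measure Ω}
    {X : ι → Ω → ℤ} (hX : iIndepFun X P) (hXm : ∀ q, AEMeasurable (X q) P)
    {S T : Finset ι} (hST : Disjoint S T) {f g : (ι → ℤ) → ℝ}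
    (hf : DependsOn f (S : Set ι)) (hg : DependsOn g (T : Set ι)) :
    IndepFun (fun ω => f fun q => X q ω) (fun ω => g fun q => X q ω) P := by
  classical
  -- A function that depends on `S` only is a function of the restriction to `S`, extended by zero.
  have factor : ∀ (R : Finset ι) (h : (ι → ℤ) → ℝ), DependsOn h (R : Set ι) →
      (fun ω => h fun q => X q ω)
        = (fun z : R → ℤ => h fun q => if hq : q ∈ R then z ⟨q, hq⟩ else 0) ∘ fun ω (q : R) => X q ω := by
    intro R h hh
    funext ω
    refine hh fun q hq => ?_
    simp [Finset.mem_coe.1 hq]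
  rw [factor S f hf, factor T g hg]
  exact (hX.indepFun_finset₀ S T hST hXm).comp .of_discrete .of_discrete

theorem integrable_of_bounded {Ω ι : Type*} [MeasurableSpace Ω] [Fintype ι] {P : Measure Ω}
    [IsFiniteMeasure P] {X : ι → Ω → ℤ} (hXm : ∀ q, AEMeasurable (X q) P)
    {f : (ι → ℤ) → ℝ} {C : ℝ} (hf : ∀ ξ, |f ξ| ≤ C) :
    Integrable (fun ω => f fun q => X q ω) P := by
  have hm : AEMeasurable (fun ω q => X q ω) P := aemeasurable_pi_iff.2 hXm
  have hf' : Measurable f := .of_discrete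
  exact Integrable.of_bound (hf'.comp_aemeasurable hm).aestronglyMeasurable C
    (Filter.Eventually.of_forall fun ω => hf _)

/-! ### The uniform distribution of the entries -/

theorem count_ofFn {n : ℕ} (v : Fin n → ℤ) (a : ℤ) :
    (List.ofFn v).count a = ∑ j, if v j = a then 1 else 0 := by
  induction n with
  | zero => simp
  | succ n ih =>
    rw [List.ofFn_succ, List.count_cons, ih, Fin.sum_univ_succ, add_comm]
    simp

theorem ae_mem_intRange {Ω : Type*} [MeasurableSpace Ω] {P : Measure Ω} {Y : Ω → ℤ} {m : ℕ}
    (h : HasLaw Y (uniformOn (intRange m)) P) : ∀ᵐ ω ∂P, Y ω ∈ intRange m := by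
  have h0 : ∀ᵐ y ∂(P.map Y), y ∈ intRange m := by
    rw [h.map_eq]
    exact ae_cond_mem (.of_discrete)
  exact ae_of_ae_map h.aemeasurable h0

theorem uniformOn_intRange_real_singleton_le {m : ℕ} (hm : 0 < m) (a : ℤ) :
    (uniformOn (intRange m)).real {a} ≤ 1 / (m : ℝ) := by
  have hcount : (m : ENNReal) ≤ Measure.count (intRange m) := by
    have h2 : intRange m
        = ((Finset.Icc (-((m / 2 : ℕ) : ℤ)) ((m / 2 : ℕ) : ℤ) : Finset ℤ) : Set ℤ) := by
      simp [intRange]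
    rw [h2, Measure.count_apply_finset]
    have h3 : m ≤ (Finset.Icc (-((m / 2 : ℕ) : ℤ)) ((m / 2 : ℕ) : ℤ)).card := by
      rw [Int.card_Icc]
      omega
    exact_mod_cast h3
  have h2 : uniformOn (intRange m) {a} ≤ (m : ENNReal)⁻¹ := by
    rw [uniformOn, cond_apply (.of_discrete)]
    calc (Measure.count (intRange m))⁻¹ * Measure.count (intRange m ∩ {a})
        ≤ (m : ENNReal)⁻¹ * Measure.count ({a} : Set ℤ) := by
          gcongr
          exact Set.inter_subset_right
      _ = (m : ENNReal)⁻¹ := by simp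
  rw [measureReal_def]
  have hm' : (m : ENNReal)⁻¹ ≠ ⊤ := by simp [hm.ne']
  simpa using ENNReal.toReal_mono hm' h2

/-! ### Second moments of the multiplicities -/

/-- The mixed second moment of the numbers of occurrences of `x` and of `y` in the `i`-th list at
level `d`, for random entries `X`. -/
noncomputable def secondMoment {Ω : Type*} [MeasurableSpace Ω] (P : Measure Ω) {k n : ℕ} (m : ℕ)
    (p : ℝ) (X : Fin k × Fin n → Ω → ℤ) (d i : ℕ) (x y : ℤ) : ℝ :=
  ∫ ω, multiplicity k n m p d i x (fun q => X q ω)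
    * multiplicity k n m p d i y (fun q => X q ω) ∂P

section

variable {Ω : Type*} [MeasurableSpace Ω] {P : Measure Ω} {k n m : ℕ}
  {p : ℝ} {X : Fin k × Fin n → Ω → ℤ}

theorem secondMoment_nonneg (d i : ℕ) (x y : ℤ) : 0 ≤ secondMoment P m p X d i x y :=
  integral_nonneg fun _ => mul_nonneg (multiplicity_nonneg ..) (multiplicity_nonneg ..)

variable [IsProbabilityMeasure P]

theorem integrable_multiplicity_mul (hXm : ∀ q, AEMeasurable (X q) P) (d i : ℕ) (x y : ℤ) :
    Integrable (fun ω => multiplicity k n m p d i x (fun q => X q ω)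
      * multiplicity k n m p d i y (fun q => X q ω)) P := by
  refine integrable_of_bounded (C := (n : ℝ) ^ 2 ^ d * (n : ℝ) ^ 2 ^ d) hXm
    (f := fun ξ => multiplicity k n m p d i x ξ * multiplicity k n m p d i y ξ) fun ξ => ?_
  rw [abs_of_nonneg (mul_nonneg (multiplicity_nonneg ..) (multiplicity_nonneg ..))]
  exact mul_le_mul (multiplicity_le ..) (multiplicity_le ..) (multiplicity_nonneg ..)
    (by positivity)

theorem dependsOn_multiplicity_mul (d i : ℕ) (x y : ℤ) :
    DependsOn (fun ξ => multiplicity k n m p d i x ξ * multiplicity k n m p d i y ξ)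
      (block k n d i : Set (Fin k × Fin n)) := fun ξ η h => by
  simp only [dependsOn_multiplicity k n m p d i x h, dependsOn_multiplicity k n m p d i y h]

/-- The two children of a node depend on disjoint blocks of entries, so their second moments
multiply. -/
theorem secondMoment_succ_le (hX : iIndepFun X P)
    (hlaw : ∀ q, HasLaw (X q) (uniformOn (intRange m)) P) (d i : ℕ) (x y : ℤ) :
    secondMoment P m p X (d + 1) i x y ≤
      ∑ a ∈ window (threshold m p d), ∑ b ∈ window (threshold m p d),
        secondMoment P m p X d (2 * i) a b
          * secondMoment P m p X d (2 * i + 1) (x - a) (y - b) := by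
  have hXm : ∀ q, AEMeasurable (X q) P := fun q => (hlaw q).aemeasurable
  set F := window (threshold m p d)
  let N : ℕ → ℕ → ℤ → Ω → ℝ := fun e j a ω => multiplicity k n m p e j a (fun q => X q ω)
  have hindep : ∀ a b, IndepFun (fun ω => N d (2 * i) a ω * N d (2 * i) b ω)
      (fun ω => N d (2 * i + 1) (x - a) ω * N d (2 * i + 1) (y - b) ω) P := fun a b =>
    indepFun_of_dependsOn hX hXm (disjoint_block k n d (by omega))
      (dependsOn_multiplicity_mul d (2 * i) a b)
      (dependsOn_multiplicity_mul d (2 * i + 1) (x - a) (y - b))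
  have hint : ∀ a b, Integrable (fun ω => (N d (2 * i) a ω * N d (2 * i) b ω)
      * (N d (2 * i + 1) (x - a) ω * N d (2 * i + 1) (y - b) ω)) P := fun a b =>
    (hindep a b).integrable_mul (integrable_multiplicity_mul hXm d (2 * i) a b)
      (integrable_multiplicity_mul hXm d (2 * i + 1) (x - a) (y - b))
  have hae : ∀ᵐ ω ∂P, ∀ q, X q ω ∈ intRange m :=
    ae_all_iff.2 fun q => ae_mem_intRange (hlaw q)
  calc secondMoment P m p X (d + 1) i x y
      ≤ ∫ ω, ∑ a ∈ F, ∑ b ∈ F, (N d (2 * i) a ω * N d (2 * i) b ω)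
          * (N d (2 * i + 1) (x - a) ω * N d (2 * i + 1) (y - b) ω) ∂P := by
        refine integral_mono_ae (integrable_multiplicity_mul hXm (d + 1) i x y)
          (integrable_finsetSum _ fun a _ => integrable_finsetSum _ fun b _ => hint a b) ?_
        filter_upwards [hae] with ω hω
        refine (mul_le_mul (multiplicity_succ_le hω d i x) (multiplicity_succ_le hω d i y)
          (multiplicity_nonneg ..) (Finset.sum_nonneg fun _ _ =>
            mul_nonneg (multiplicity_nonneg ..) (multiplicity_nonneg ..))).trans_eq ?_
        rw [Finset.sum_mul_sum]
        exact Finset.sum_congr rfl fun a _ => Finset.sum_congr rfl fun b _ => mul_mul_mul_comm ..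
    _ = ∑ a ∈ F, ∑ b ∈ F, secondMoment P m p X d (2 * i) a b
          * secondMoment P m p X d (2 * i + 1) (x - a) (y - b) := by
        rw [integral_finsetSum _ fun a _ => integrable_finsetSum _ fun b _ => hint a b]
        refine Finset.sum_congr rfl fun a _ => ?_
        rw [integral_finsetSum _ fun b _ => hint a b]
        refine Finset.sum_congr rfl fun b _ => ?_
        exact (hindep a b).integral_mul_eq_mul_integral
          (integrable_multiplicity_mul hXm d (2 * i) a b).aestronglyMeasurable
          (integrable_multiplicity_mul hXm d (2 * i + 1) (x - a) (y - b)).aestronglyMeasurable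

/-- At a leaf, the `n` pairs of equal positions give the diagonal part and the pairs of distinct,
hence independent, positions the constant part. Lists beyond the first `k` are empty, so there is
no condition on `i`. -/
theorem secondMoment_zero_le (hm : 0 < m) (hX : iIndepFun X P)
    (hlaw : ∀ q, HasLaw (X q) (uniformOn (intRange m)) P) (i : ℕ) (x y : ℤ) :
    secondMoment P m p X 0 i x y ≤ (n : ℝ) / m * (if x = y then 1 else 0) + ((n : ℝ) / m) ^ 2 := by
  have hXm : ∀ q, AEMeasurable (X q) P := fun q => (hlaw q).aemeasurable
  have hnn : 0 ≤ (n : ℝ) / m * (if x = y then 1 else 0) + ((n : ℝ) / m) ^ 2 := by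
    split_ifs <;> positivity
  by_cases hi : i < k
  swap
  · have h0 : secondMoment P m p X 0 i x y = 0 := by
      simp [secondMoment, multiplicity, level, inputLists, hi]
    rwa [h0]
  let hit : Fin n → ℤ → Ω → ℝ := fun j a ω => if X (⟨i, hi⟩, j) ω = a then 1 else 0
  have hmult : ∀ a ω, multiplicity k n m p 0 i a (fun q => X q ω) = ∑ j, hit j a ω := by
    intro a ω
    simp only [multiplicity, level, inputLists, hi, dif_pos, hit, count_ofFn]
    push_cast
    rfl
  have hint1 : ∀ j a, Integrable (hit j a) P := fun j a =>
    integrable_of_bounded (C := 1) hXm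
      (f := fun ξ => if ξ (⟨i, hi⟩, j) = a then 1 else 0) fun ξ => by split_ifs <;> simp
  have hint2 : ∀ j j', Integrable (fun ω => hit j x ω * hit j' y ω) P := fun j j' =>
    integrable_of_bounded (C := 1) hXm
      (f := fun ξ => (if ξ (⟨i, hi⟩, j) = x then 1 else 0)
        * (if ξ (⟨i, hi⟩, j') = y then 1 else 0)) fun ξ => by split_ifs <;> simp
  have hmean : ∀ j a, ∫ ω, hit j a ω ∂P ≤ 1 / (m : ℝ) := by
    intro j a
    have h1 : ∫ ω, hit j a ω ∂P = (uniformOn (intRange m)).real {a} := by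
      have h2 : (fun z : ℤ => if z = a then (1 : ℝ) else 0) = ({a} : Set ℤ).indicator 1 := by
        funext z
        simp [Set.indicator_apply]
      rw [← integral_indicator_one (.of_discrete), ← h2]
      exact (hlaw (⟨i, hi⟩, j)).integral_comp
        (f := fun z : ℤ => if z = a then (1 : ℝ) else 0)
        (Measurable.of_discrete.aestronglyMeasurable)
    exact h1.trans_le (uniformOn_intRange_real_singleton_le hm a)
  have hmean0 : ∀ j a, 0 ≤ ∫ ω, hit j a ω ∂P := fun j a =>
    integral_nonneg fun ω => by simp only [hit]; positivity
  have hpair : ∀ j j', ∫ ω, hit j x ω * hit j' y ω ∂P ≤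
      (if j = j' then 1 / (m : ℝ) * (if x = y then 1 else 0) else 0) + (1 / (m : ℝ)) ^ 2 := by
    intro j j'
    by_cases hj : j = j'
    · subst hj
      rw [if_pos rfl]
      refine le_add_of_le_of_nonneg ?_ (by positivity)
      by_cases hxy : x = y
      · subst hxy
        have h1 : (fun ω => hit j x ω * hit j x ω) = hit j x := by
          funext ω
          simp [hit]
        rw [h1, if_pos rfl, mul_one]
        exact hmean j x
      · have h1 : (fun ω => hit j x ω * hit j y ω) = fun _ => 0 := by
          funext ω
          simp only [hit]
          split_ifs <;> simp_all
        rw [h1, if_neg hxy]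
        simp
    · rw [if_neg hj, zero_add]
      have hI : IndepFun (hit j x) (hit j' y) P :=
        (hX.indepFun (i := (⟨i, hi⟩, j)) (j := (⟨i, hi⟩, j')) (by simpa using hj)).comp
          (φ := fun z : ℤ => if z = x then (1 : ℝ) else 0)
          (ψ := fun z : ℤ => if z = y then (1 : ℝ) else 0) .of_discrete .of_discrete
      have h1 : ∫ ω, hit j x ω * hit j' y ω ∂P = (∫ ω, hit j x ω ∂P) * ∫ ω, hit j' y ω ∂P :=
        hI.integral_mul_eq_mul_integral (hint1 j x).aestronglyMeasurable
          (hint1 j' y).aestronglyMeasurable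
      rw [h1, sq]
      exact mul_le_mul (hmean _ _) (hmean _ _) (hmean0 _ _) (by positivity)
  have hsum : secondMoment P m p X 0 i x y = ∑ j, ∑ j', ∫ ω, hit j x ω * hit j' y ω ∂P := by
    simp only [secondMoment, hmult, Finset.sum_mul_sum]
    rw [integral_finsetSum _ fun j _ => integrable_finsetSum _ fun j' _ => hint2 j j']
    exact Finset.sum_congr rfl fun j _ => integral_finsetSum _ fun j' _ => hint2 j j'
  rw [hsum]
  refine (Finset.sum_le_sum fun j _ => Finset.sum_le_sum fun j' _ => hpair j j').trans_eq ?_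
  simp only [Finset.sum_add_distrib, Finset.sum_ite_eq, Finset.mem_univ, if_true,
    Finset.sum_const, Finset.card_univ, Fintype.card_fin, nsmul_eq_mul]
  ring

/-- The merge step for bounds of the form `α * 1[a = b] + β`. Diagonal times diagonal is again
diagonal and leaves one free summation variable; diagonal times constant also leaves one, while
constant times constant leaves two. -/
theorem sum_sum_diagonal_le {F : Finset ℤ} {w α β : ℝ} (hα : 0 ≤ α) (hβ : 0 ≤ β)
    (hw : (F.card : ℝ) ≤ w) {G H : ℤ → ℤ → ℝ}
    (hH0 : ∀ a b, 0 ≤ H a b)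
    (hG : ∀ a b, G a b ≤ α * (if a = b then 1 else 0) + β)
    (hH : ∀ a b, H a b ≤ α * (if a = b then 1 else 0) + β) (x y : ℤ) :
    ∑ a ∈ F, ∑ b ∈ F, G a b * H (x - a) (y - b) ≤
      α ^ 2 * w * (if x = y then 1 else 0) + (2 * α * β * w + β ^ 2 * w ^ 2) := by
  have hw0 : 0 ≤ w := (Nat.cast_nonneg _).trans hw
  have hterm : ∀ a b, G a b * H (x - a) (y - b) ≤
      (if a = b then α ^ 2 * (if x = y then 1 else 0) + α * β else 0)
        + (if b = y - x + a then α * β else 0) + β ^ 2 := by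
    intro a b
    refine (mul_le_mul (hG a b) (hH (x - a) (y - b)) (hH0 _ _) (by positivity)).trans_eq ?_
    have hiff : (x - a = y - b) ↔ b = y - x + a := by omega
    simp only [hiff]
    by_cases h1 : a = b
    · subst h1
      have h2 : (a = y - x + a) ↔ x = y := by omega
      simp only [h2]
      split_ifs <;> ring
    · simp only [if_neg h1]
      split_ifs <;> ring
  refine (Finset.sum_le_sum fun a _ => Finset.sum_le_sum fun b _ => hterm a b).trans ?_
  have hshift : ∀ a ∈ F, ∑ b ∈ F, (if b = y - x + a then α * β else 0) ≤ α * β := by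
    intro a _
    rw [Finset.sum_ite_eq']
    split_ifs
    · exact le_rfl
    · positivity
  calc _ ≤ ∑ a ∈ F, ((α ^ 2 * (if x = y then 1 else 0) + α * β) + α * β
          + F.card * β ^ 2) := by
        refine Finset.sum_le_sum fun a ha => ?_
        rw [Finset.sum_add_distrib, Finset.sum_add_distrib, Finset.sum_ite_eq, if_pos ha,
          Finset.sum_const, nsmul_eq_mul]
        linarith [hshift a ha]
    _ = F.card * (α ^ 2 * (if x = y then 1 else 0) + 2 * α * β) + (F.card : ℝ) ^ 2 * β ^ 2 := by
        rw [Finset.sum_const, nsmul_eq_mul]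
        ring
    _ ≤ w * (α ^ 2 * (if x = y then 1 else 0) + 2 * α * β) + w ^ 2 * β ^ 2 := by
        gcongr
    _ = _ := by ring

/-- At every node of level `d`, the second moment is at most `α d` on the diagonal plus `β d`
everywhere, for any sequences that dominate the recursion given by `sum_sum_diagonal_le` with at
most `p ^ d * m + 1` integers in the window of level `d`. -/
theorem secondMoment_le (hm : 0 < m) (hp : 0 ≤ p) (hX : iIndepFun X P)
    (hlaw : ∀ q, HasLaw (X q) (uniformOn (intRange m)) P) {K : ℕ} {α β : ℕ → ℝ}
    (hα : ∀ d, 0 ≤ α d) (hβ : ∀ d, 0 ≤ β d)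
    (hα0 : (n : ℝ) / m ≤ α 0) (hβ0 : ((n : ℝ) / m) ^ 2 ≤ β 0)
    (hαs : ∀ d < K, α d ^ 2 * (p ^ d * m + 1) ≤ α (d + 1))
    (hβs : ∀ d < K, 2 * α d * β d * (p ^ d * m + 1) + β d ^ 2 * (p ^ d * m + 1) ^ 2 ≤ β (d + 1))
    {d : ℕ} (hd : d ≤ K) (i : ℕ) (x y : ℤ) :
    secondMoment P m p X d i x y ≤ α d * (if x = y then 1 else 0) + β d := by
  induction d generalizing i x y with
  | zero =>
    refine (secondMoment_zero_le hm hX hlaw i x y).trans (add_le_add ?_ hβ0)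
    exact mul_le_mul_of_nonneg_right hα0 (by positivity)
  | succ d ih =>
    have hcard : ((window (threshold m p d)).card : ℝ) ≤ p ^ d * m + 1 := by
      have h0 : 0 ≤ threshold m p d := by rw [threshold_eq]; positivity
      refine (card_window_le h0).trans_eq ?_
      rw [threshold_eq]
      ring
    refine (secondMoment_succ_le hX hlaw d i x y).trans
      ((sum_sum_diagonal_le (hα d) (hβ d) hcard (secondMoment_nonneg d (2 * i + 1))
        (ih (by omega) (2 * i)) (ih (by omega) (2 * i + 1)) x y).trans
        (add_le_add ?_ (hβs d hd)))
    exact mul_le_mul_of_nonneg_right (hαs d hd) (by positivity)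

end

/-! ### The recursive bound -/

theorem T_one (μ : ℝ) (n : ℕ) (ν : ℝ) : T μ n ν 1 = n * μ * ν := by
  rw [T, if_pos le_rfl]

theorem T_two_pow_succ (μ : ℝ) (n : ℕ) (ν : ℝ) (d : ℕ) :
    T μ n ν (2 ^ (d + 1)) = T μ n ν (2 ^ d) * (T μ n ν (2 ^ d) / ν + 2 * μ) := by
  have h1 : ¬ 2 ^ (d + 1) ≤ 1 := by
    have := Nat.one_lt_two_pow (n := d + 1) (by omega)
    omega
  have h2 : 2 ^ (d + 1) / 2 = 2 ^ d := by rw [pow_succ]; omega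
  rw [T, if_neg h1, h2]

theorem T_two_pow_nonneg {μ ν : ℝ} (hμ : 0 ≤ μ) (hν : 0 ≤ ν) (n d : ℕ) :
    0 ≤ T μ n ν (2 ^ d) := by
  induction d with
  | zero => rw [pow_zero, T_one]; positivity
  | succ d ih => rw [T_two_pow_succ]; positivity

end KTree

theorem proposition2p4
    {Ω : Type*} [MeasurableSpace Ω] (P : Measure Ω) [IsProbabilityMeasure P]
    (k K n m : ℕ) (p μ ν : ℝ)
    (hk : k = 2 ^ K)
    (hp0 : 0 < p) (hp : p < 1 / 30)
    (hm : 30 < (m : ℝ) * p ^ ((K : ℤ) - 1))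
    (hμ : μ = p * ((1 - p)⁻¹ * (1 + 35 / ((m : ℝ) * p ^ K))))
    (hν : ν = 1 / ((m : ℝ) * p ^ (K + 1)))
    (X : Fin k → Fin n → Ω → ℤ)
    (hindep : iIndepFun (fun (ij : Fin k × Fin n) (ω : Ω) => X ij.1 ij.2 ω) P)
    (hunif : ∀ i j, HasLaw (X i j) (uniformOn (KTree.intRange m)) P) :
    Integrable (fun ω => (KTree.zeroCount m p (fun i j => X i j ω) : ℝ) ^ 2) P ∧
      ∫ ω, (KTree.zeroCount m p (fun i j => X i j ω) : ℝ) ^ 2 ∂P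
        ≤ ((n : ℝ) ^ k * μ ^ k * ν) * (1 + KTree.T μ n ν k) := by
  have hm0 : 0 < m := by
    rcases Nat.eq_zero_or_pos m with rfl | h
    · norm_num at hm
    · exact h
  have hmR : (0 : ℝ) < m := Nat.cast_pos.2 hm0
  have hp1 : p ≤ 1 := by linarith
  let Y : Fin k × Fin n → Ω → ℤ := fun q => X q.1 q.2
  have hlaw : ∀ q, HasLaw (Y q) (uniformOn (KTree.intRange m)) P := fun q => hunif q.1 q.2
  have hsq : (fun ω => (KTree.zeroCount m p (fun i j => X i j ω) : ℝ) ^ 2)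
      = fun ω => KTree.multiplicity k n m p K 0 0 (fun q => Y q ω)
        * KTree.multiplicity k n m p K 0 0 (fun q => Y q ω) := by
    funext ω
    have hlog : Nat.log 2 k = K := by rw [hk, Nat.log_pow (by norm_num)]
    rw [sq, KTree.zeroCount, hlog]
    rfl
  rw [hsq]
  refine ⟨KTree.integrable_multiplicity_mul (fun q => (hlaw q).aemeasurable) K 0 0 0, ?_⟩
  -- At every merge the window contains at most `p ^ d * m + 1 ≤ c * (p ^ d * m)` integers. The
  -- factor `c` is absorbed by making both bounds smaller by the factor `c`, which the slack
  -- between `p` and `μ` allows at the leaves.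
  set c : ℝ := 1 + 1 / ((m : ℝ) * p ^ K) with hc
  have hc0 : 0 < c := by positivity
  have hw : ∀ d < K, p ^ d * m + 1 ≤ c * (p ^ d * m) := by
    intro d hd
    have h1 : m * p ^ K ≤ p ^ d * m := by
      rw [mul_comm]
      exact mul_le_mul_of_nonneg_right (pow_le_pow_of_le_one hp0.le hp1 hd.le) hmR.le
    have h2 : 1 ≤ 1 / ((m : ℝ) * p ^ K) * (p ^ d * m) := by
      rw [one_div, ← div_eq_inv_mul, one_le_div (by positivity)]
      exact h1
    rw [hc, add_mul, one_mul]
    linarith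
  have hpinv : 1 ≤ (1 - p)⁻¹ := (one_le_inv₀ (by linarith)).2 (by linarith)
  have hcμ : c * p ≤ μ := by
    rw [hμ, mul_comm]
    refine mul_le_mul_of_nonneg_left ?_ hp0.le
    calc c ≤ 1 + 35 / ((m : ℝ) * p ^ K) := by
          rw [hc]
          gcongr
          norm_num
      _ ≤ _ := le_mul_of_one_le_left (by positivity) hpinv
  have hpμ : p ≤ μ := (le_mul_of_one_le_left hp0.le (by rw [hc]; simp; positivity)).trans hcμ
  have hμ0 : 0 < μ := hp0.trans_le hpμ
  have hν0 : 0 < ν := by rw [hν]; positivity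
  -- `s d` is the analogue of `ν` at level `d`. Since `U d = T (2 ^ d) / ν` obeys the recursion
  -- `U (d + 1) = U d * (U d + 2 * μ)`, free of `ν`, the ratio `t d` of the two parts of the bound
  -- at level `d` is compared with `s d * U d`, and only `s K = ν` matters in the end.
  let s : ℕ → ℝ := fun d => 1 / (m * p ^ (d + 1))
  let U : ℕ → ℝ := fun d => KTree.T μ n ν (2 ^ d) / ν
  have hs0 : ∀ d, 0 < s d := fun d => by simp only [s]; positivity
  have hss : ∀ d, s d ^ 2 * (p ^ d * m) = s (d + 1) := fun d => by
    simp only [s]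
    field_simp
    ring
  have hsp : ∀ d, s d * (p ^ d * m) = 1 / p := fun d => by
    simp only [s]
    field_simp
    ring
  have hs_succ : ∀ d, s d = p * s (d + 1) := fun d => by
    simp only [s]
    field_simp
    ring
  have hU0 : ∀ d, 0 ≤ U d := fun d =>
    div_nonneg (KTree.T_two_pow_nonneg hμ0.le hν0.le n d) hν0.le
  have hUs : ∀ d, U (d + 1) = U d * (U d + 2 * μ) := fun d => by
    simp only [U, KTree.T_two_pow_succ]
    ring
  let α : ℕ → ℝ := fun d => s d * (n * μ) ^ 2 ^ d / c
  let t : ℕ → ℝ := fun d => s d * U d / c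
  have hα0 : ∀ d, 0 ≤ α d := fun d => by have := hs0 d; simp only [α]; positivity
  have ht0 : ∀ d, 0 ≤ t d := fun d => by have := hs0 d; have := hU0 d; simp only [t]; positivity
  have hbase : (n : ℝ) / m ≤ s 0 * (n * μ) / c := by
    rw [le_div_iff₀ hc0]
    calc (n : ℝ) / m * c = n / m * (c * p) / p := by field_simp
      _ ≤ n / m * μ / p := by gcongr
      _ = s 0 * (n * μ) := by
          simp only [s]
          field_simp
          ring
  have hαs : ∀ d < K, α d ^ 2 * (p ^ d * m + 1) ≤ α (d + 1) := by
    intro d hd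
    calc α d ^ 2 * (p ^ d * m + 1) ≤ α d ^ 2 * (c * (p ^ d * m)) := by
          gcongr
          exact hw d hd
      _ = α (d + 1) := by
          simp only [α]
          rw [← hss d, pow_succ 2 d, pow_mul]
          field_simp
  have hts : ∀ d < K, t d * (2 + t d * (p ^ d * m + 1)) ≤ t (d + 1) := by
    intro d hd
    have h1 : t d * (p ^ d * m + 1) ≤ U d / p := by
      calc t d * (p ^ d * m + 1) ≤ t d * (c * (p ^ d * m)) :=
            mul_le_mul_of_nonneg_left (hw d hd) (ht0 d)
        _ = (s d * (p ^ d * m)) * U d := by simp only [t]; field_simp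
        _ = U d / p := by rw [hsp]; ring
    calc t d * (2 + t d * (p ^ d * m + 1)) ≤ t d * (2 + U d / p) :=
          mul_le_mul_of_nonneg_left (by linarith) (ht0 d)
      _ = s (d + 1) / c * (U d * (U d + 2 * p)) := by
          simp only [t]
          rw [hs_succ d]
          field_simp
          ring
      _ ≤ s (d + 1) / c * (U d * (U d + 2 * μ)) := by
          have := hs0 (d + 1)
          have := hU0 d
          gcongr
      _ = t (d + 1) := by simp only [t]; rw [hUs]; ring
  have hmain := KTree.secondMoment_le hm0 hp0.le hindep hlaw (K := K) (α := α)
    (β := fun d => α d * t d) hα0 (fun d => mul_nonneg (hα0 d) (ht0 d))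
    (by simpa [α] using hbase)
    (by
      have h1 : t 0 = s 0 * (n * μ) / c := by simp [t, U, KTree.T_one, hν0.ne']
      have h2 : α 0 = s 0 * (n * μ) / c := by simp [α]
      rw [h1, h2, ← sq]
      exact pow_le_pow_left₀ (by positivity) hbase 2)
    hαs
    (by
      intro d hd
      calc 2 * α d * (α d * t d) * (p ^ d * m + 1) + (α d * t d) ^ 2 * (p ^ d * m + 1) ^ 2
          = (α d ^ 2 * (p ^ d * m + 1)) * (t d * (2 + t d * (p ^ d * m + 1))) := by ring
        _ ≤ α (d + 1) * t (d + 1) := by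
            have := ht0 d
            exact mul_le_mul (hαs d hd) (hts d hd) (by positivity) (hα0 _))
    le_rfl 0 0 0
  rw [if_pos rfl, mul_one] at hmain
  refine hmain.trans ?_
  have hsK : s K = ν := hν.symm
  have hc1 : 1 ≤ c := by rw [hc]; simp; positivity
  have hαK : α K ≤ n ^ k * μ ^ k * ν := by
    simp only [α]
    rw [hsK, ← hk, mul_pow, mul_comm]
    exact div_le_self (by positivity) hc1
  have htK : t K ≤ KTree.T μ n ν k := by
    have h1 : s K * U K = KTree.T μ n ν k := by
      simp only [U]
      rw [hsK, ← hk]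
      field_simp
    simp only [t]
    rw [h1]
    exact div_le_self (by rw [hk]; exact KTree.T_two_pow_nonneg hμ0.le hν0.le n K) hc1
  calc α K + α K * t K = α K * (1 + t K) := by ring
    _ ≤ _ := mul_le_mul hαK (by linarith) (by linarith [ht0 K]) (by positivity)
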